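/- Let $K$ be a field, let $n \ge 0$ be an integer, and let $I$ be the monomial ideal in the polynomial ring $S = K[a,b,c,d,x_1,y_1,\ldots,x_n,y_n]$ generated by $a^6,\ a^5b,\ ab^5,\ b^6,\ a^4b^4c,\ a^4b^4d$ and $a^4x_iy_i^2,\ b^4x_i^2y_i$ for $i = 1,\ldots,n$. For an integer $k \ge 1$ let $f(k) = \operatorname{depth}(S/I^k)$, where the depth of a finitely generated graded $S$-module $M \neq 0$ is the maximal length of an $M$-regular sequence contained in the graded maximal ideal $(a,b,c,d,x_1,y_1,\ldots,x_n,y_n)$. Then $$ f(k) = \begin{cases} 0, & \text{if } k \text{ is odd and } k \le 2n+1;\\ 1, & \text{if } k \text{ is even and } k \le 2n;\\ 2, & \text{if } k > 2n+1. \end{cases} $$ In particular, $f$ (as a function on the positive integers) has precisely $n$ strict local maxima, where $k \ge 1$ is a strict local maximum of $f$ if $f(j) < f(k)$ for every integer $j \ge 1$ with $|j-k| = 1$. -/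

import Mathlib

open MvPolynomial

/-- The `2n + 4` variables `a, b, c, d, x₁, y₁, …, xₙ, yₙ`. -/
inductive Vars (n : ℕ) : Type
  | a : Vars n
  | b : Vars n
  | c : Vars n
  | d : Vars n
  | x (i : Fin n) : Vars n
  | y (i : Fin n) : Vars n

/-- The depth (or grade) of an `R`-module `M` with respect to an ideal `J`: the supremum of the
lengths of the `M`-regular sequences whose members all lie in `J`. -/
noncomputable def idealDepth {R : Type*} [CommRing R] (J : Ideal R) (M : Type*) [AddCommGroup M]
    [Module R M] : ℕ∞ :=
  ⨆ rs ∈ {rs : List R | (∀ r ∈ rs, r ∈ J) ∧ RingTheory.Sequence.IsRegular M rs},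
    (rs.length : ℕ∞)

/-- The graded maximal ideal of a polynomial ring, generated by all the variables. -/
noncomputable def gradedMaximalIdeal (K σ : Type*) [Field K] : Ideal (MvPolynomial σ K) :=
  Ideal.span (Set.range X)

/-- The depth function `k ↦ depth (S / I ^ k)` of an ideal `I` of a polynomial ring `S`; depth is
taken with respect to the graded maximal ideal. Only the values at `k ≥ 1` are meaningful. -/
noncomputable def depthFunction {K σ : Type*} [Field K] (I : Ideal (MvPolynomial σ K)) (k : ℕ) :
    ℕ∞ :=
  idealDepth (gradedMaximalIdeal K σ) (MvPolynomial σ K ⧸ I ^ k)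

/-- The monomial ideal generated by `a⁶, a⁵b, ab⁵, b⁶, a⁴b⁴c, a⁴b⁴d` and `a⁴xᵢyᵢ², b⁴xᵢ²yᵢ` for
all `i`. -/
noncomputable def strangeIdeal (K : Type*) [Field K] (n : ℕ) : Ideal (MvPolynomial (Vars n) K) :=
  Ideal.span
    ({X .a ^ 6, X .a ^ 5 * X .b, X .a * X .b ^ 5, X .b ^ 6,
        X .a ^ 4 * X .b ^ 4 * X .c, X .a ^ 4 * X .b ^ 4 * X .d} ∪
      Set.range (fun i : Fin n => X .a ^ 4 * X (.x i) * X (.y i) ^ 2) ∪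
      Set.range (fun i : Fin n => X .b ^ 4 * X (.x i) ^ 2 * X (.y i)))

/-- `k` is a strict local maximum of the function `f` on the positive integers: `k ≥ 1` and `f` is
strictly smaller at each neighbour of `k` among the positive integers. -/
def IsStrictLocalMaxAt {α : Type*} [LT α] (f : ℕ → α) (k : ℕ) : Prop :=
  1 ≤ k ∧ ∀ j : ℕ, 1 ≤ j → (j + 1 = k ∨ j = k + 1) → f j < f k

/-! ### Depth bounds over Noetherian rings -/

section DepthBound

open RingTheory.Sequence Pointwise

/-! Everything reduces to monomials `u` outside `I ^ k`. If every variable outside a set `Z`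
multiplies `u` into `I ^ k`, the depth is at most `Z.card`, since depth is bounded by `dim R/p` for
any associated prime `p` (after localizing). If no `u` is sent into `I ^ k` by all variables, the
depth is positive.

The heart is `exists_isTight_of_divisibleByPow`: if `c * u` lies in `I ^ k` but `u` does not,
exchanging generators forces `u = a^(4+4s) b^(4+4t)` times a monomial in the `xᵢ, yᵢ` that admits at
most one factor `xᵢyᵢ²` and one factor `xᵢ²yᵢ` per index, with totals `s`, `t` and `k = s + t + 1`.
Conversely, such a `u` never lies in `I ^ k` (`IsTight.not_divisibleByPow`).

Since `s + t ≤ 2n`, no such `u` exists for `k > 2n + 1`, so `c, d` is a regular sequence. For `k`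
even, `s + t` is odd, so some index carries exactly one factor; the exponent of one of `xᵢ, yᵢ` is
then unconstrained, and that variable does not multiply `u` into `I ^ k`. For odd `k ≤ 2n + 1`,
taking `s = t` with both factors or none at each index gives a socle monomial. -/

theorem exists_lt_associatedPrimes_quotSMulTop {R M : Type*} [CommRing R] [IsLocalRing R]
    [IsNoetherianRing R] [AddCommGroup M] [Module R M] [Module.Finite R M] {r : R}
    (hr : r ∈ IsLocalRing.maximalIdeal R) (hreg : IsSMulRegular M r) {p : Ideal R}
    (hp : p ∈ associatedPrimes R M) :
    ∃ q ∈ associatedPrimes R (QuotSMulTop r M), p < q := by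
  obtain ⟨-, x, hx⟩ := isAssociatedPrime_iff.mp (AssociatedPrimes.mem_iff.mp hp)
  have hpx : ∀ s, s ∈ p ↔ s • x = 0 := fun s => by
    rw [hx, Submodule.mem_colon_singleton, Submodule.mem_bot]
  have hx0 : x ≠ 0 := by
    rintro rfl
    exact hp.1.ne_top ((Ideal.eq_top_iff_one _).mpr ((hpx 1).mpr (smul_zero _)))
  let N : Submodule R M := Submodule.torsionBySet R M p
  have hN : ∀ v, v ∈ N ↔ ∀ s ∈ p, s • v = 0 := fun v => by
    simp [N, Submodule.mem_torsionBySet_iff]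
  have hxN : x ∈ N := (hN x).mpr fun s hs => (hpx s).mp hs
  -- If the submodule `N` killed by `p` were inside `rM`, regularity of `r` would give `N = rN`,
  -- hence `N = 0` by Nakayama. So some `v ∈ N` survives in `M/rM`, where it is killed by both `p`
  -- and `r ∉ p`.
  obtain ⟨v, hvN, hv⟩ : ∃ v ∈ N, v ∉ r • (⊤ : Submodule R M) := by
    by_contra! h
    have hle : N ≤ Ideal.span {r} • N := by
      intro v hv
      obtain ⟨v', -, rfl⟩ := (Submodule.mem_smul_pointwise_iff_exists _ _ _).mp (h v hv)
      refine Submodule.smul_mem_smul (Ideal.mem_span_singleton_self r) ((hN v').mpr fun s hs => ?_)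
      refine hreg ?_
      simpa [smul_comm r s] using (hN _).mp hv s hs
    have := Submodule.eq_bot_of_le_smul_of_le_jacobson_bot (Ideal.span {r}) N
      (IsNoetherian.noetherian N) hle (by
        rw [Ideal.span_singleton_le_iff_mem, IsLocalRing.jacobson_eq_maximalIdeal _ bot_ne_top]
        exact hr)
    rw [this] at hxN
    exact hx0 (by simpa using hxN)
  obtain ⟨q, hq, hle⟩ := exists_le_isAssociatedPrime_of_isNoetherianRing R
    (Submodule.Quotient.mk v : QuotSMulTop r M) (by rwa [Ne, Submodule.Quotient.mk_eq_zero])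
  refine ⟨q, hq, lt_of_le_of_ne (fun s hs => hle ?_) ?_⟩
  · rw [Submodule.mem_colon_singleton, ← Submodule.Quotient.mk_smul, (hN v).mp hvN s hs]
    simp
  · rintro rfl
    refine hx0 (hreg ?_)
    have : r ∈ p := hle (by
      rw [Submodule.mem_colon_singleton, ← Submodule.Quotient.mk_smul, Submodule.mem_bot,
        Submodule.Quotient.mk_eq_zero]
      exact Submodule.smul_mem_pointwise_smul _ _ _ trivial)
    simpa using (hpx r).mp this

/-- Each element of the sequence yields a strictly larger prime, associated to the next quotient, so
a regular sequence produces a chain of primes above `p`. -/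
theorem RingTheory.Sequence.IsWeaklyRegular.length_le_coheight {R M : Type*} [CommRing R]
    [IsLocalRing R] [IsNoetherianRing R] [AddCommGroup M] [Module R M] [Module.Finite R M]
    {rs : List R} (hrs : ∀ r ∈ rs, r ∈ IsLocalRing.maximalIdeal R) (hreg : IsWeaklyRegular M rs)
    {p : PrimeSpectrum R} (hp : p.asIdeal ∈ associatedPrimes R M) :
    (rs.length : ℕ∞) ≤ Order.coheight p := by
  induction rs generalizing M p with
  | nil => simp
  | cons r rs ih =>
    rw [isWeaklyRegular_cons_iff] at hreg
    obtain ⟨q, hq, hlt⟩ := exists_lt_associatedPrimes_quotSMulTop (hrs r (by simp)) hreg.1 hp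
    have := ih (fun s hs => hrs s (by simp [hs])) hreg.2 (p := ⟨q, hq.1⟩) hq
    rw [List.length_cons, Nat.cast_succ]
    exact (add_le_add_left this 1).trans (Order.coheight_add_one_le hlt)

/-- Krull's height theorem in `R/p`, whose maximal ideal is generated by the image of `Z`. -/
theorem coheight_le_card_of_maximalIdeal_le {R : Type*} [CommRing R] [IsLocalRing R]
    [IsNoetherianRing R] (p : PrimeSpectrum R) (Z : Finset R)
    (hZm : (Z : Set R) ⊆ IsLocalRing.maximalIdeal R)
    (hZ : IsLocalRing.maximalIdeal R ≤ p.asIdeal ⊔ Ideal.span Z) :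
    Order.coheight p ≤ Z.card := by
  classical
  have : IsLocalRing (R ⧸ p.asIdeal) :=
    IsLocalRing.of_surjective' (Ideal.Quotient.mk p.asIdeal) Ideal.Quotient.mk_surjective
  have hdim : (Order.coheight p : WithBot ℕ∞) = ringKrullDim (R ⧸ p.asIdeal) := by
    rw [ringKrullDim_quotient, Order.coheight_eq_krullDim_Ici]
    congr
  have hle : IsLocalRing.maximalIdeal (R ⧸ p.asIdeal) ≤
      Ideal.span ((Z.image (Ideal.Quotient.mk p.asIdeal) : Finset _) : Set (R ⧸ p.asIdeal)) := by
    intro y hy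
    obtain ⟨x, rfl⟩ := Ideal.Quotient.mk_surjective y
    have hx : x ∈ IsLocalRing.maximalIdeal R := fun hu => hy (hu.map _)
    have := Ideal.mem_map_of_mem (Ideal.Quotient.mk p.asIdeal) (hZ hx)
    rw [Ideal.map_sup, Ideal.map_quotient_self, bot_sup_eq, Ideal.map_span] at this
    simpa using this
  have heq := hle.antisymm (Ideal.span_le.mpr (by
    intro y hy
    obtain ⟨z, hz, rfl⟩ := Finset.mem_image.mp hy
    refine (IsLocalRing.mem_maximalIdeal _).mpr fun hu => ?_
    obtain ⟨b, hb⟩ := isUnit_iff_exists_inv.mp hu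
    obtain ⟨b, rfl⟩ := Ideal.Quotient.mk_surjective b
    have hb' : z * b - 1 ∈ p.asIdeal := Ideal.Quotient.eq.mp (by simpa using hb)
    refine Ideal.IsPrime.ne_top' ((Ideal.eq_top_iff_one (IsLocalRing.maximalIdeal R)).mpr ?_)
    simpa using Ideal.sub_mem _ (Ideal.mul_mem_right b _ (hZm hz))
      (IsLocalRing.le_maximalIdeal p.2.ne_top hb')))
  have hd : (Order.coheight p : WithBot ℕ∞) ≤ (Z.card : ℕ∞) := by
    rw [hdim, ← IsLocalRing.maximalIdeal_height_eq_ringKrullDim, WithBot.coe_le_coe]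
    refine (Ideal.height_le_spanFinrank _ Ideal.IsPrime.ne_top').trans ?_
    rw [heq]
    refine (Submodule.spanFinrank_span_le_encard _).trans ?_
    rw [Set.encard_coe_eq_coe_finsetCard, Nat.cast_le]
    exact Finset.card_image_le
  exact WithBot.coe_le_coe.mp hd

/-- Localize at `m`: `w` survives because its annihilator lies in `m`, and an associated prime
containing that annihilator contains `P`, so its coheight is at most the number of elements of `Z`.
-/
theorem RingTheory.Sequence.IsWeaklyRegular.length_le_card {R M : Type*} [CommRing R]
    [IsNoetherianRing R] [AddCommGroup M] [Module R M] [Module.Finite R M] (m : Ideal R)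
    [m.IsPrime] {P : Ideal R} {Z : Finset R} (hZm : (Z : Set R) ⊆ m)
    (hZ : m ≤ P ⊔ Ideal.span Z) {w : M}
    (hw : ∀ r : R, r • w = 0 → r ∈ m) (hP : ∀ r ∈ P, r • w = 0)
    {rs : List R} (hrs : ∀ r ∈ rs, r ∈ m) (hreg : IsWeaklyRegular M rs) :
    rs.length ≤ Z.card := by
  classical
  let f := LocalizedModule.mkLinearMap m.primeCompl M
  have hf := hreg.of_isLocalizedModule (Localization.AtPrime m) m.primeCompl f
  have hw0 : f w ≠ 0 := by
    intro h
    obtain ⟨c, hc⟩ := (IsLocalizedModule.eq_zero_iff m.primeCompl f).mp h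
    exact c.2 (hw c hc)
  obtain ⟨p, hp, hle⟩ := exists_le_isAssociatedPrime_of_isNoetherianRing (Localization.AtPrime m)
    (f w) hw0
  have hPp : P.map (algebraMap R (Localization.AtPrime m)) ≤ p := by
    refine Ideal.map_le_iff_le_comap.mpr fun r hr => hle ?_
    rw [Submodule.mem_colon_singleton, algebraMap_smul, ← map_smul, hP r hr]
    simp
  have h1 := hf.length_le_coheight (p := ⟨p, hp.1⟩) (by
    intro r hr
    obtain ⟨s, hs, rfl⟩ := List.mem_map.mp hr
    exact (IsLocalization.AtPrime.to_map_mem_maximal_iff _ m s).mpr (hrs s hs)) hp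
  have h2 := coheight_le_card_of_maximalIdeal_le ⟨p, hp.1⟩
    (Z.image (algebraMap R (Localization.AtPrime m))) (by
      intro y hy
      obtain ⟨z, hz, rfl⟩ := Finset.mem_image.mp hy
      exact (IsLocalization.AtPrime.to_map_mem_maximal_iff _ m z).mpr (hZm hz)) (by
      rw [← Localization.AtPrime.map_eq_maximalIdeal]
      refine (Ideal.map_mono hZ).trans ?_
      rw [Ideal.map_sup, Ideal.map_span]
      simpa using sup_le_sup_right hPp _)
  have h3 := h1.trans h2
  rw [List.length_map, Nat.cast_le] at h3
  exact h3.trans Finset.card_image_le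

theorem idealDepth_le_card {R M : Type*} [CommRing R]
    [IsNoetherianRing R] [AddCommGroup M] [Module R M] [Module.Finite R M] (m : Ideal R)
    [m.IsPrime] {P : Ideal R} {Z : Finset R} (hZm : (Z : Set R) ⊆ m)
    (hZ : m ≤ P ⊔ Ideal.span Z) {w : M}
    (hw : ∀ r : R, r • w = 0 → r ∈ m) (hP : ∀ r ∈ P, r • w = 0) :
    idealDepth m M ≤ Z.card :=
  iSup₂_le fun _ hrs => Nat.cast_le.mpr (hrs.2.1.length_le_card m hZm hZ hw hP hrs.1)

theorem length_le_idealDepth {R M : Type*} [CommRing R] [AddCommGroup M] [Module R M]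
    {J : Ideal R} {rs : List R} (hrs : ∀ r ∈ rs, r ∈ J) (hreg : IsRegular M rs) :
    (rs.length : ℕ∞) ≤ idealDepth J M :=
  le_iSup₂_of_le (f := fun (rs : List R) (_ : rs ∈ {rs : List R | (∀ r ∈ rs, r ∈ J) ∧
    IsRegular M rs}) => (rs.length : ℕ∞)) rs ⟨hrs, hreg⟩ le_rfl

theorem isRegular_of_isWeaklyRegular_quotient {R : Type*} [CommRing R] {I J : Ideal R}
    (hJ : J ≠ ⊤) (hI : I ≤ J) {rs : List R} (hrs : ∀ r ∈ rs, r ∈ J)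
    (hreg : IsWeaklyRegular (R ⧸ I) rs) : IsRegular (R ⧸ I) rs := by
  refine ⟨hreg, fun h => hJ ((Ideal.eq_top_iff_one _).mpr ?_)⟩
  have h1 : (Ideal.Quotient.mk I 1) ∈ Ideal.ofList rs • (⊤ : Submodule R (R ⧸ I)) := h ▸ trivial
  have h2 : Ideal.ofList rs • (⊤ : Submodule R (R ⧸ I)) ≤ Submodule.map I.mkQ J := by
    refine Submodule.smul_le.mpr fun r hr x _ => ?_
    obtain ⟨y, rfl⟩ := Ideal.Quotient.mk_surjective x
    refine ⟨r * y, J.mul_mem_right y (Ideal.span_le.mpr hrs hr), rfl⟩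
  obtain ⟨y, hy, hy1⟩ := h2 h1
  have : y - 1 ∈ I := Ideal.Quotient.eq.mp hy1
  simpa using J.sub_mem hy (hI this)

/-- If no nonzero element of `M` is annihilated by the maximal ideal `m`, then `m` has positive
depth on `M`. -/
theorem exists_isSMulRegular_of_forall_smul_eq_zero {R M : Type*} [CommRing R]
    [IsNoetherianRing R] [AddCommGroup M] [Module R M] [Module.Finite R M] (m : Ideal R)
    [m.IsMaximal] (h : ∀ w : M, (∀ r ∈ m, r • w = 0) → w = 0) :
    ∃ r ∈ m, IsSMulRegular M r := by
  by_contra! hcon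
  have hsub : (m : Set R) ⊆ ⋃ p ∈ associatedPrimes R M, (p : Set R) := by
    rw [biUnion_associatedPrimes_eq_zero_divisors]
    intro r hr
    have := hcon r hr
    rw [isSMulRegular_iff_right_eq_zero_of_smul] at this
    push Not at this
    obtain ⟨x, hx, hx0⟩ := this
    exact ⟨x, hx0, hx⟩
  obtain ⟨p, hp, hmp⟩ := (Ideal.subset_union_prime_finite (associatedPrimes.finite R M) 0 0
    (fun p hp _ _ => hp.1)).mp hsub
  obtain ⟨-, x, hx⟩ := isAssociatedPrime_iff.mp (AssociatedPrimes.mem_iff.mp hp)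
  have hx0 : x = 0 := h x fun r hr => by
    have := hmp hr
    rwa [hx, Submodule.mem_colon_singleton, Submodule.mem_bot] at this
  refine hp.1.ne_top ?_
  rw [hx, hx0, Ideal.eq_top_iff_one, Submodule.mem_colon_singleton]
  simp

end DepthBound

/-! ### Depth of quotients by monomial ideals -/

section MonomialIdeal

open RingTheory.Sequence Pointwise

variable {K σ : Type*} [Field K]

theorem span_monomial_image_pow (E : Set (σ →₀ ℕ)) (k : ℕ) :
    Ideal.span ((fun e => monomial e (1 : K)) '' E) ^ k =
      Ideal.span ((fun e => monomial e (1 : K)) '' (k • E)) := by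
  induction k with
  | zero => simp [Ideal.one_eq_top]
  | succ k ih =>
    rw [pow_succ, ih, Ideal.span_mul_span', succ_nsmul]
    congr 1
    exact (Set.image_image2_distrib (fun a b => by simp [monomial_mul])).symm

theorem mem_gradedMaximalIdeal_iff {f : MvPolynomial σ K} :
    f ∈ gradedMaximalIdeal K σ ↔ coeff 0 f = 0 := by
  rw [gradedMaximalIdeal, ← Set.image_univ, mem_ideal_span_X_image]
  constructor
  · intro h
    by_contra h0
    obtain ⟨i, -, hi⟩ := h 0 (mem_support_iff.mpr h0)
    exact hi rfl
  · intro h e he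
    by_contra! hcon
    have : e = 0 := Finsupp.ext fun i => hcon i trivial
    exact mem_support_iff.mp he (this ▸ h)

instance isMaximal_gradedMaximalIdeal : (gradedMaximalIdeal K σ).IsMaximal := by
  have : gradedMaximalIdeal K σ = RingHom.ker (constantCoeff (σ := σ) (R := K)) := by
    ext f
    rw [mem_gradedMaximalIdeal_iff, RingHom.mem_ker, constantCoeff_eq]
  rw [this]
  exact RingHom.ker_isMaximal_of_surjective _ fun r => ⟨C r, constantCoeff_C _ r⟩

theorem X_mem_gradedMaximalIdeal (v : σ) : (X v : MvPolynomial σ K) ∈ gradedMaximalIdeal K σ :=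
  Ideal.subset_span ⟨v, rfl⟩

theorem idealDepth_le_of_monomial [Finite σ] {E : Set (σ →₀ ℕ)} {w : σ →₀ ℕ}
    (hw : ¬ ∃ g ∈ E, g ≤ w) {Z : Finset σ}
    (hZ : ∀ v ∉ Z, ∃ g ∈ E, g ≤ w + Finsupp.single v 1) :
    idealDepth (gradedMaximalIdeal K σ)
      (MvPolynomial σ K ⧸ Ideal.span ((fun e => monomial e (1 : K)) '' E)) ≤ Z.card := by
  classical
  refine (idealDepth_le_card (gradedMaximalIdeal K σ)
    (P := Ideal.span (X '' (Z : Set σ)ᶜ)) (Z := Z.image X)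
    (w := Ideal.Quotient.mk _ (monomial w 1)) ?_ ?_ ?_ ?_).trans
    (Nat.cast_le.mpr Finset.card_image_le)
  · intro y hy
    obtain ⟨z, -, rfl⟩ := Finset.mem_image.mp hy
    exact X_mem_gradedMaximalIdeal z
  · refine Ideal.span_le.mpr ?_
    rintro _ ⟨v, rfl⟩
    by_cases hv : v ∈ Z
    · exact Ideal.mem_sup_right (Ideal.subset_span (by simpa using hv))
    · exact Ideal.mem_sup_left (Ideal.subset_span ⟨v, hv, rfl⟩)
  · intro r hr
    rw [mem_gradedMaximalIdeal_iff]
    by_contra h0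
    have h1 : r * monomial w 1 ∈ Ideal.span ((fun e => monomial e (1 : K)) '' E) :=
      Ideal.Quotient.eq_zero_iff_mem.mp hr
    refine hw (mem_ideal_span_monomial_image.mp h1 w (mem_support_iff.mpr ?_))
    -- The coefficient of `r * monomial w 1` at `w` is the constant term of `r`.
    simpa [coeff_mul_monomial'] using h0
  · intro r hr
    suffices r * monomial w 1 ∈ Ideal.span ((fun e => monomial e (1 : K)) '' E) from
      Ideal.Quotient.eq_zero_iff_mem.mpr this
    induction hr using Submodule.span_induction with
    | mem y hy =>
      obtain ⟨v, hv, rfl⟩ := hy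
      obtain ⟨g, hg, hle⟩ := hZ v hv
      rw [mul_comm, X, monomial_mul, one_mul, mem_ideal_span_monomial_image]
      intro e he
      rw [Finset.mem_singleton.mp (support_monomial_subset he)]
      exact ⟨g, hg, hle⟩
    | zero => simp
    | add y z _ _ hy hz => rw [add_mul]; exact Ideal.add_mem _ hy hz
    | smul a y _ hy => rw [smul_eq_mul, mul_assoc]; exact Ideal.mul_mem_left _ _ hy

theorem mem_of_X_mul_mem {E : Set (σ →₀ ℕ)} {v : σ} {f : MvPolynomial σ K} {e : σ →₀ ℕ}
    (he : e ∈ f.support)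
    (h : X v * f ∈ Ideal.span ((fun e => monomial e (1 : K)) '' E)) :
    ∃ g ∈ E, g ≤ e + Finsupp.single v 1 := by
  refine mem_ideal_span_monomial_image.mp h _ (mem_support_iff.mpr ?_)
  rw [add_comm, coeff_X_mul]
  exact mem_support_iff.mp he

/-- Membership in a monomial ideal is tested term by term, so a socle element has only socle
monomials as terms. -/
theorem exists_isSMulRegular_of_no_socle [Finite σ] {E : Set (σ →₀ ℕ)}
    (h : ∀ w : σ →₀ ℕ, (∀ v, ∃ g ∈ E, g ≤ w + Finsupp.single v 1) → ∃ g ∈ E, g ≤ w) :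
    ∃ r ∈ gradedMaximalIdeal K σ, IsSMulRegular
      (MvPolynomial σ K ⧸ Ideal.span ((fun e => monomial e (1 : K)) '' E)) r := by
  refine exists_isSMulRegular_of_forall_smul_eq_zero (gradedMaximalIdeal K σ) fun x hx => ?_
  obtain ⟨f, rfl⟩ := Ideal.Quotient.mk_surjective x
  rw [Ideal.Quotient.eq_zero_iff_mem, mem_ideal_span_monomial_image]
  exact fun e he => h e fun v => mem_of_X_mul_mem (f := f) he
    (Ideal.Quotient.eq_zero_iff_mem.mp (hx _ (X_mem_gradedMaximalIdeal v)))

theorem isWeaklyRegular_X_X {E : Set (σ →₀ ℕ)} {u v : σ} (huv : u ≠ v)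
    (hu : ∀ w : σ →₀ ℕ, (∃ g ∈ E, g ≤ w + Finsupp.single u 1) → ∃ g ∈ E, g ≤ w)
    (hv : ∀ w : σ →₀ ℕ, (∃ g ∈ E, g ≤ w + Finsupp.single v 1) → ∃ g ∈ E, g ≤ w) :
    IsWeaklyRegular (MvPolynomial σ K ⧸ Ideal.span ((fun e => monomial e (1 : K)) '' E))
      ([X u, X v] : List (MvPolynomial σ K)) := by
  classical
  rw [isWeaklyRegular_cons_iff, isWeaklyRegular_singleton_iff,
    isSMulRegular_iff_right_eq_zero_of_smul, isSMulRegular_iff_right_eq_zero_of_smul]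
  constructor
  · intro x hx
    obtain ⟨f, rfl⟩ := Ideal.Quotient.mk_surjective x
    rw [Ideal.Quotient.eq_zero_iff_mem, mem_ideal_span_monomial_image]
    exact fun e he => hu e (mem_of_X_mul_mem he (Ideal.Quotient.eq_zero_iff_mem.mp hx))
  · intro x hx
    obtain ⟨x, rfl⟩ := Submodule.Quotient.mk_surjective _ x
    obtain ⟨f, rfl⟩ := Ideal.Quotient.mk_surjective x
    rw [← Submodule.Quotient.mk_smul, Submodule.Quotient.mk_eq_zero,
      Submodule.mem_smul_pointwise_iff_exists] at hx
    obtain ⟨x, -, hx⟩ := hx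
    obtain ⟨g, rfl⟩ := Ideal.Quotient.mk_surjective x
    have hfg : X u * g - X v * f ∈ Ideal.span ((fun e => monomial e (1 : K)) '' E) :=
      Ideal.Quotient.eq.mp hx
    -- A term of `f` not divisible by `X u` cannot cancel against `X u * g`, so `X v` times it lies
    -- in the ideal; all other terms are multiples of `X u`.
    have hf : f ∈ Ideal.span ((fun e => monomial e (1 : K)) '' (E ∪ {Finsupp.single u 1})) := by
      rw [mem_ideal_span_monomial_image]
      intro e he
      by_cases heu : e u = 0
      · obtain ⟨s, hs, hle⟩ := hv e (by
          refine mem_ideal_span_monomial_image.mp hfg _ (mem_support_iff.mpr ?_)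
          have h0 : coeff (e + Finsupp.single v 1) (X u * g) = 0 := by
            rw [coeff_X_mul', if_neg]
            simp [heu, huv.symm]
          rw [coeff_sub, h0, add_comm e, coeff_X_mul, zero_sub, neg_ne_zero]
          exact mem_support_iff.mp he)
        exact ⟨s, Or.inl hs, hle⟩
      · refine ⟨_, Or.inr rfl, ?_⟩
        rw [Finsupp.single_le_iff]
        omega
    rw [Set.image_union, Ideal.span_union, Set.image_singleton] at hf
    obtain ⟨i, hi, j, hj, rfl⟩ := Submodule.mem_sup.mp hf
    obtain ⟨h, rfl⟩ := Ideal.mem_span_singleton.mp hj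
    rw [Submodule.Quotient.mk_eq_zero, Submodule.mem_smul_pointwise_iff_exists]
    refine ⟨Ideal.Quotient.mk _ h, trivial, ?_⟩
    refine (Ideal.Quotient.eq (x := X u * h)).mpr ?_
    change X u * h - (i + X u * h) ∈ _
    simpa using hi

end MonomialIdeal

/-! ### Combinatorics of the exponents -/

/-- The monomial with exponents `ea, eb, ec, ed` in `a, b, c, d` and `ex i, ey i` in `xᵢ, yᵢ` is
divisible by a product of `k` generators of the ideal `strangeIdeal K n`. The numbers `r₁, …, r₄`,
`p`, `q`, `α i`, `β i` are the multiplicities of the generators. -/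
def DivisibleByPow {n : ℕ} (k ea eb ec ed : ℕ) (ex ey : Fin n → ℕ) : Prop :=
  ∃ (r₁ r₂ r₃ r₄ p q : ℕ) (α β : Fin n → ℕ),
    r₁ + r₂ + r₃ + r₄ + p + q + ∑ i, α i + ∑ i, β i = k ∧
    6 * r₁ + 5 * r₂ + r₃ + 4 * p + 4 * q + 4 * ∑ i, α i ≤ ea ∧
    r₂ + 5 * r₃ + 6 * r₄ + 4 * p + 4 * q + 4 * ∑ i, β i ≤ eb ∧
    p ≤ ec ∧ q ≤ ed ∧ (∀ i, α i + 2 * β i ≤ ex i) ∧ ∀ i, 2 * α i + β i ≤ ey i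

namespace DivisibleByPow

variable {n k ea eb ec ed : ℕ} {ex ey : Fin n → ℕ}

theorem swap_cd (h : DivisibleByPow k ea eb ec ed ex ey) :
    DivisibleByPow k ea eb ed ec ex ey := by
  obtain ⟨r₁, r₂, r₃, r₄, p, q, α, β, h1, h2, h3, h4, h5, h6, h7⟩ := h
  exact ⟨r₁, r₂, r₃, r₄, q, p, α, β, by omega, by omega, by omega, h5, h4, h6, h7⟩

end DivisibleByPow

theorem sum_update_add {ι : Type*} [Fintype ι] [DecidableEq ι] (α : ι → ℕ) (i : ι) (m : ℕ) :
    ∑ j, Function.update α i m j + α i = ∑ j, α j + m := by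
  rw [Finset.sum_update_of_mem (Finset.mem_univ i), ← Finset.erase_eq,
    ← Finset.add_sum_erase Finset.univ α (Finset.mem_univ i)]
  omega

/-- The exponents `ex i, ey i` of `xᵢ, yᵢ` allow no more factors `xᵢyᵢ²` and no more factors
`xᵢ²yᵢ` than the multiplicities `α i, β i ≤ 1`. -/
def IsTight {n : ℕ} (α β ex ey : Fin n → ℕ) : Prop :=
  ∀ i, (α i = 1 ∧ β i = 1 ∧ ex i = 3 ∧ ey i = 3) ∨ (α i = 1 ∧ β i = 0 ∧ ex i = 1) ∨
    (α i = 0 ∧ β i = 1 ∧ ey i = 1) ∨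
    (α i = 0 ∧ β i = 0 ∧ ¬ (1 ≤ ex i ∧ 2 ≤ ey i) ∧ ¬ (2 ≤ ex i ∧ 1 ≤ ey i))

theorem IsTight.not_divisibleByPow {n : ℕ} {α β ex ey : Fin n → ℕ} (h : IsTight α β ex ey) :
    ¬ DivisibleByPow (∑ i, α i + ∑ i, β i + 1) (4 + 4 * ∑ i, α i) (4 + 4 * ∑ i, β i) 0 0 ex ey := by
  rintro ⟨r₁, r₂, r₃, r₄, p, q, α', β', h1, h2, h3, h4, h5, h6, h7⟩
  have hα : ∑ i, α' i ≤ ∑ i, α i := Finset.sum_le_sum fun i _ => by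
    have := h i; have := h6 i; have := h7 i; omega
  have hβ : ∑ i, β' i ≤ ∑ i, β i := Finset.sum_le_sum fun i _ => by
    have := h i; have := h6 i; have := h7 i; omega
  generalize ∑ i, α i = s at *
  generalize ∑ i, β i = t at *
  generalize ∑ i, α' i = s' at *
  generalize ∑ i, β' i = t' at *
  -- Adding the `a`- and `b`-degrees gives `6R ≤ 4R + 4` for `R = r₁ + r₂ + r₃ + r₄`. One such
  -- factor does not fit into `a⁴b⁴`; two would have to equal `a⁸b⁴` or `a⁴b⁸`, which no two of `a⁶,
  -- a⁵b, ab⁵, b⁶` do.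
  have hr : r₁ + r₂ + r₃ + r₄ ≤ 2 := by omega
  have hr₁ : r₁ ≤ 2 := by omega
  have hr₂ : r₂ ≤ 2 := by omega
  have hr₃ : r₃ ≤ 2 := by omega
  have hr₄ : r₄ ≤ 2 := by omega
  interval_cases r₁ <;> interval_cases r₂ <;> interval_cases r₃ <;> interval_cases r₄ <;> omega

/-- If multiplication by `c` moves a monomial into the `k`-th power of the ideal, the monomial is
`a ^ (4 + 4s) b ^ (4 + 4t)` times a tight monomial in the remaining variables. -/
theorem exists_isTight_of_divisibleByPow {n k ea eb ec ed : ℕ} {ex ey : Fin n → ℕ}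
    (h : DivisibleByPow k ea eb (ec + 1) ed ex ey) (hn : ¬ DivisibleByPow k ea eb ec ed ex ey) :
    ∃ α β : Fin n → ℕ, IsTight α β ex ey ∧ k = ∑ i, α i + ∑ i, β i + 1 ∧
      ea = 4 + 4 * ∑ i, α i ∧ eb = 4 + 4 * ∑ i, β i ∧ ec = 0 ∧ ed = 0 := by
  classical
  obtain ⟨r₁, r₂, r₃, r₄, p, q, α, β, h1, h2, h3, h4, h5, h6, h7⟩ := h
  have hp : p = ec + 1 := by
    by_contra hne
    exact hn ⟨r₁, r₂, r₃, r₄, p, q, α, β, h1, h2, h3, by omega, h5, h6, h7⟩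
  -- Each exchange avoids one factor `a⁴b⁴c`: here `(a⁵b)²` divides `a⁶ · a⁴b⁴c`, and below `a⁶ ·
  -- ab⁵` divides both `a⁵b · a⁴b⁴c` and any product of two among `a⁴b⁴c, a⁴b⁴d`.
  have hr₁ : r₁ = 0 := by
    by_contra hne
    exact hn ⟨r₁ - 1, r₂ + 2, r₃, r₄, p - 1, q, α, β, by omega, by omega, by omega, by omega, h5,
      h6, h7⟩
  have hr₂ : r₂ = 0 := by
    by_contra hne
    exact hn ⟨r₁ + 1, r₂ - 1, r₃ + 1, r₄, p - 1, q, α, β, by omega, by omega, by omega, by omega,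
      h5, h6, h7⟩
  have hr₃ : r₃ = 0 := by
    by_contra hne
    exact hn ⟨r₁, r₂ + 1, r₃ - 1, r₄ + 1, p - 1, q, α, β, by omega, by omega, by omega, by omega,
      h5, h6, h7⟩
  have hr₄ : r₄ = 0 := by
    by_contra hne
    exact hn ⟨r₁, r₂, r₃ + 2, r₄ - 1, p - 1, q, α, β, by omega, by omega, by omega, by omega, h5,
      h6, h7⟩
  have hq : q = 0 := by
    by_contra hne
    exact hn ⟨1, 0, 1, 0, p - 1, q - 1, α, β, by omega, by omega, by omega, by omega, by omega,
      h6, h7⟩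
  have hec : ec = 0 := by
    by_contra hne
    exact hn ⟨1, 0, 1, 0, p - 2, q, α, β, by omega, by omega, by omega, by omega, h5, h6, h7⟩
  have hed : ed = 0 := by
    by_contra hne
    exact hn ⟨0, 0, 0, 0, 0, 1, α, β, by omega, by omega, by omega, by omega, by omega, h6, h7⟩
  subst hr₁ hr₂ hr₃ hr₄ hq hec hed hp
  -- A spare `a` would allow `a⁵b` in place of `a⁴b⁴c`; symmetrically for `b`.
  have hea : ea = 4 + 4 * ∑ i, α i := by
    by_contra hne
    exact hn ⟨0, 1, 0, 0, 0, 0, α, β, by omega, by omega, by omega, by omega, by omega, h6, h7⟩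
  have heb : eb = 4 + 4 * ∑ i, β i := by
    by_contra hne
    exact hn ⟨0, 0, 1, 0, 0, 0, α, β, by omega, by omega, by omega, by omega, by omega, h6, h7⟩
  refine ⟨α, β, fun i => ?_, by omega, hea, heb, rfl, rfl⟩
  -- No rearrangement at a single index may absorb the factor `a⁴b⁴c`.
  have key : ∀ r₁ r₄ s t, ¬ (r₁ + r₄ + s + t = α i + β i + 1 ∧
      6 * r₁ + 4 * s ≤ 4 + 4 * α i ∧ 6 * r₄ + 4 * t ≤ 4 + 4 * β i ∧ s + 2 * t ≤ ex i ∧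
      2 * s + t ≤ ey i) := by
    rintro r₁ r₄ s t ⟨g1, g2, g3, g4, g5⟩
    have hα := sum_update_add α i s
    have hβ := sum_update_add β i t
    refine hn ⟨r₁, 0, 0, r₄, 0, 0, Function.update α i s, Function.update β i t, by omega,
      by omega, by omega, by omega, by omega, fun j => ?_, fun j => ?_⟩
    · by_cases hj : j = i
      · subst hj; simpa using g4
      · simpa [hj] using h6 j
    · by_cases hj : j = i
      · subst hj; simpa using g5
      · simpa [hj] using h7 j
  have h6i := h6 i
  have h7i := h7 i
  clear h1 h2 h3 h6 h7 hn
  generalize α i = s, β i = t, ex i = x, ey i = y at *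
  -- Two factors `a⁴xᵢyᵢ²` together with `a⁴b⁴` contain `(a⁶)² · b⁴xᵢ²yᵢ`.
  have hs : s ≤ 1 := by
    by_contra hc
    exact key 2 0 (s - 2) (t + 1) ⟨by omega, by omega, by omega, by omega, by omega⟩
  have ht : t ≤ 1 := by
    by_contra hc
    exact key 0 2 (s + 1) (t - 2) ⟨by omega, by omega, by omega, by omega, by omega⟩
  interval_cases s <;> interval_cases t
  · have k1 := key 0 0 1 0
    have k2 := key 0 0 0 1
    clear key; omega
  · have k4 := key 0 1 1 0
    clear key; omega
  · have k3 := key 1 0 0 1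
    clear key; omega
  · have k3 := key 1 0 0 2
    have k4 := key 0 1 2 0
    clear key; omega

theorem IsTight.sum_le {n : ℕ} {α β ex ey : Fin n → ℕ} (h : IsTight α β ex ey) :
    ∑ i, α i + ∑ i, β i ≤ 2 * n := by
  rw [← Finset.sum_add_distrib]
  refine (Finset.sum_le_card_nsmul _ _ 2 fun i _ => ?_).trans (by simp [mul_comm])
  have := h i; omega

theorem divisibleByPow_of_two_mul_add_one_lt {n k ea eb ec ed : ℕ} {ex ey : Fin n → ℕ}
    (hk : 2 * n + 1 < k) (h : DivisibleByPow k ea eb (ec + 1) ed ex ey) :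
    DivisibleByPow k ea eb ec ed ex ey := by
  by_contra hn
  obtain ⟨α, β, ht, hs, -⟩ := exists_isTight_of_divisibleByPow h hn
  have := ht.sum_le
  omega

theorem divisibleByPow_of_even {n k ea eb ec ed : ℕ} {ex ey : Fin n → ℕ} (hk : Even k)
    (hc : DivisibleByPow k ea eb (ec + 1) ed ex ey)
    (hx : ∀ i, DivisibleByPow k ea eb ec ed (Function.update ex i (ex i + 1)) ey)
    (hy : ∀ i, DivisibleByPow k ea eb ec ed ex (Function.update ey i (ey i + 1))) :
    DivisibleByPow k ea eb ec ed ex ey := by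
  by_contra hn
  obtain ⟨α, β, ht, rfl, rfl, rfl, rfl, rfl⟩ := exists_isTight_of_divisibleByPow hc hn
  -- Here `k = ∑ α + ∑ β + 1` is even, so the sum of the `α i + β i` is odd.
  obtain ⟨i, hi⟩ : ∃ i, ¬ Even (α i + β i) := by
    by_contra! hall
    have := Finset.even_sum (s := Finset.univ) (fun i => α i + β i) fun i _ => hall i
    rw [Finset.sum_add_distrib] at this
    exact (Nat.even_add_one.mp hk) this
  have hti := ht i
  have hor : (α i = 1 ∧ β i = 0 ∧ ex i = 1) ∨ (α i = 0 ∧ β i = 1 ∧ ey i = 1) := by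
    rcases hti with h | h | h | h
    · exact absurd (by rw [h.1, h.2.1]; decide) hi
    · exact Or.inl h
    · exact Or.inr h
    · exact absurd (by rw [h.1, h.2.1]; decide) hi
  rcases hor with h | h
  -- With only the factor `xᵢyᵢ²` present, tightness bounds `ex i` but not `ey i`, so raising `ey i`
  -- keeps the monomial tight and outside the power.
  · refine IsTight.not_divisibleByPow (fun j => ?_) (hy i)
    by_cases hj : j = i
    · subst hj; exact Or.inr (Or.inl h)
    · simpa [hj] using ht j
  · refine IsTight.not_divisibleByPow (fun j => ?_) (hx i)
    by_cases hj : j = i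
    · subst hj; exact Or.inr (Or.inr (Or.inl h))
    · simpa [hj] using ht j

/-- Exchange the factors at one index `i`: if `s` factors `xᵢyᵢ²`, `t` factors `xᵢ²yᵢ` and powers of
`a⁶` and `b⁶` fit, the monomial with the multiplicities `α`, `β` elsewhere is divisible. -/
theorem divisibleByPow_of_exchange {n : ℕ} {α β ex ey : Fin n → ℕ} {k : ℕ}
    (hk : k = ∑ i, α i + ∑ i, β i + 1) (hx : ∀ i, α i + 2 * β i ≤ ex i)
    (hy : ∀ i, 2 * α i + β i ≤ ey i) (i : Fin n) (s t r₁ r₄ : ℕ)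
    (h1 : r₁ + r₄ + s + t = α i + β i + 1) (h2 : 6 * r₁ + 4 * s ≤ 4 + 4 * α i)
    (h3 : 6 * r₄ + 4 * t ≤ 4 + 4 * β i) {ex' ey' : Fin n → ℕ}
    (hex : ∀ j, ex j ≤ ex' j) (hey : ∀ j, ey j ≤ ey' j)
    (hx' : s + 2 * t ≤ ex' i) (hy' : 2 * s + t ≤ ey' i) :
    DivisibleByPow k (4 + 4 * ∑ i, α i) (4 + 4 * ∑ i, β i) 0 0 ex' ey' := by
  have hα := sum_update_add α i s
  have hβ := sum_update_add β i t
  refine ⟨r₁, 0, 0, r₄, 0, 0, Function.update α i s, Function.update β i t, by omega,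
    by omega, by omega, by omega, by omega, fun j => ?_, fun j => ?_⟩
  · by_cases hj : j = i
    · subst hj; simpa using hx'
    · simpa [hj] using (hx j).trans (hex j)
  · by_cases hj : j = i
    · subst hj; simpa using hy'
    · simpa [hj] using (hy j).trans (hey j)

/-! ### Translation between monomials and exponent conditions -/

section Strange

open Finsupp Pointwise

instance (n : ℕ) : Finite (Vars n) := by
  let f : Vars n → Fin 4 ⊕ Fin n ⊕ Fin n := fun v => match v with
    | .a => .inl 0
    | .b => .inl 1
    | .c => .inl 2
    | .d => .inl 3
    | .x i => .inr (.inl i)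
    | .y i => .inr (.inr i)
  refine Finite.of_injective f fun u v h => ?_
  cases u <;> cases v <;> simp_all [f]

/-- The exponents of the generators of `strangeIdeal K n`. -/
noncomputable def strangeExponents (n : ℕ) : Set (Vars n →₀ ℕ) :=
  {single .a 6, single .a 5 + single .b 1, single .a 1 + single .b 5, single .b 6,
      single .a 4 + single .b 4 + single .c 1, single .a 4 + single .b 4 + single .d 1} ∪
    Set.range (fun i : Fin n => single .a 4 + single (.x i) 1 + single (.y i) 2) ∪
    Set.range (fun i : Fin n => single .b 4 + single (.x i) 2 + single (.y i) 1)

theorem strangeIdeal_eq_span (K : Type*) [Field K] (n : ℕ) :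
    strangeIdeal K n = Ideal.span ((fun e => monomial e (1 : K)) '' strangeExponents n) := by
  rw [strangeIdeal, strangeExponents]
  simp only [Set.image_union, Set.image_insert_eq, Set.image_singleton, ← Set.range_comp,
    Function.comp_def, X_pow_eq_monomial, monomial_mul, one_mul]
  simp only [X, monomial_mul, mul_one]

theorem add_mem_add_nsmul {A : Type*} [AddCommMonoid A] {E : Set A} {i j : ℕ} {g h : A}
    (hg : g ∈ i • E) (hh : h ∈ j • E) : g + h ∈ (i + j) • E := by
  rw [add_nsmul]
  exact Set.add_mem_add hg hh

theorem sum_nsmul_mem_sum_nsmul {A ι : Type*} [AddCommMonoid A] [Fintype ι] {E : Set A}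
    (α : ι → ℕ) {g : ι → A} (hg : ∀ i, g i ∈ E) : ∑ i, α i • g i ∈ (∑ i, α i) • E := by
  rw [← Finset.sum_nsmul_assoc]
  exact Set.finsetSum_mem_finsetSum _ _ _ fun i _ => Set.nsmul_mem_nsmul (hg i)

theorem exists_nsmul_strangeExponents_le_iff {n k : ℕ} {e : Vars n →₀ ℕ} :
    (∃ g ∈ k • strangeExponents n, g ≤ e) ↔
      DivisibleByPow k (e .a) (e .b) (e .c) (e .d) (fun i => e (.x i)) (fun i => e (.y i)) := by
  classical
  constructor
  · suffices ∀ g ∈ k • strangeExponents n, DivisibleByPow k (g .a) (g .b) (g .c) (g .d)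
        (fun i => g (.x i)) (fun i => g (.y i)) by
      rintro ⟨g, hg, hle⟩
      obtain ⟨r₁, r₂, r₃, r₄, p, q, α, β, h1, h2, h3, h4, h5, h6, h7⟩ := this g hg
      exact ⟨r₁, r₂, r₃, r₄, p, q, α, β, h1, h2.trans (hle _), h3.trans (hle _), h4.trans (hle _),
        h5.trans (hle _), fun i => (h6 i).trans (hle _), fun i => (h7 i).trans (hle _)⟩
    induction k with
    | zero =>
      intro g _
      exact ⟨0, 0, 0, 0, 0, 0, 0, 0, by simp, by simp, by simp, by simp, by simp, by simp, by simp⟩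
    | succ k ih =>
      intro g hg
      rw [succ_nsmul, Set.mem_add] at hg
      obtain ⟨g, hg, s, hs, rfl⟩ := hg
      obtain ⟨r₁, r₂, r₃, r₄, p, q, α, β, h1, h2, h3, h4, h5, h6, h7⟩ := ih g hg
      simp only [strangeExponents, Set.mem_union, Set.mem_insert_iff, Set.mem_singleton_iff,
        Set.mem_range] at hs
      rcases hs with ((rfl | rfl | rfl | rfl | rfl | rfl) | ⟨i, rfl⟩) | ⟨i, rfl⟩
      · exact ⟨r₁ + 1, r₂, r₃, r₄, p, q, α, β, by omega, by simp; omega, by simpa using h3,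
          by simpa using h4, by simpa using h5, by simpa using h6, by simpa using h7⟩
      · exact ⟨r₁, r₂ + 1, r₃, r₄, p, q, α, β, by omega, by simp; omega, by simp; omega,
          by simpa using h4, by simpa using h5, by simpa using h6, by simpa using h7⟩
      · exact ⟨r₁, r₂, r₃ + 1, r₄, p, q, α, β, by omega, by simp; omega, by simp; omega,
          by simpa using h4, by simpa using h5, by simpa using h6, by simpa using h7⟩
      · exact ⟨r₁, r₂, r₃, r₄ + 1, p, q, α, β, by omega, by simpa using h2, by simp; omega,
          by simpa using h4, by simpa using h5, by simpa using h6, by simpa using h7⟩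
      · exact ⟨r₁, r₂, r₃, r₄, p + 1, q, α, β, by omega, by simp; omega, by simp; omega,
          by simpa using h4, by simpa using h5, by simpa using h6, by simpa using h7⟩
      · exact ⟨r₁, r₂, r₃, r₄, p, q + 1, α, β, by omega, by simp; omega, by simp; omega,
          by simpa using h4, by simpa using h5, by simpa using h6, by simpa using h7⟩
      · have := sum_update_add α i (α i + 1)
        refine ⟨r₁, r₂, r₃, r₄, p, q, Function.update α i (α i + 1), β, by omega, by simp; omega,
          by simpa using h3, by simpa using h4, by simpa using h5, fun j => ?_, fun j => ?_⟩
        · have : α j + 2 * β j ≤ g (.x j) := h6 j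
          by_cases hj : j = i
          · subst hj; simp; omega
          · simp [hj]; omega
        · have : 2 * α j + β j ≤ g (.y j) := h7 j
          by_cases hj : j = i
          · subst hj; simp; omega
          · simp [hj]; omega
      · have := sum_update_add β i (β i + 1)
        refine ⟨r₁, r₂, r₃, r₄, p, q, α, Function.update β i (β i + 1), by omega,
          by simpa using h2, by simp; omega, by simpa using h4, by simpa using h5,
          fun j => ?_, fun j => ?_⟩
        · have : α j + 2 * β j ≤ g (.x j) := h6 j
          by_cases hj : j = i
          · subst hj; simp; omega
          · simp [hj]; omega
        · have : 2 * α j + β j ≤ g (.y j) := h7 j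
          by_cases hj : j = i
          · subst hj; simp; omega
          · simp [hj]; omega
  · rintro ⟨r₁, r₂, r₃, r₄, p, q, α, β, h1, h2, h3, h4, h5, h6, h7⟩
    let G : Vars n → ℕ → (Vars n →₀ ℕ) := single
    refine ⟨r₁ • G .a 6 + r₂ • (G .a 5 + G .b 1) +
      r₃ • (G .a 1 + G .b 5) + r₄ • G .b 6 + p • (G .a 4 + G .b 4 + G .c 1) +
      q • (G .a 4 + G .b 4 + G .d 1) + ∑ i, α i • (G .a 4 + G (.x i) 1 + G (.y i) 2) +
      ∑ i, β i • (G .b 4 + G (.x i) 2 + G (.y i) 1), ?_, fun v => ?_⟩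
    · rw [← h1]
      refine add_mem_add_nsmul (add_mem_add_nsmul (add_mem_add_nsmul (add_mem_add_nsmul
        (add_mem_add_nsmul (add_mem_add_nsmul (add_mem_add_nsmul (Set.nsmul_mem_nsmul ?_)
        (Set.nsmul_mem_nsmul ?_)) (Set.nsmul_mem_nsmul ?_)) (Set.nsmul_mem_nsmul ?_))
        (Set.nsmul_mem_nsmul ?_)) (Set.nsmul_mem_nsmul ?_))
        (sum_nsmul_mem_sum_nsmul α fun i => Or.inl (Or.inr ⟨i, rfl⟩)))
        (sum_nsmul_mem_sum_nsmul β fun i => Or.inr ⟨i, rfl⟩)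
      all_goals simp [strangeExponents, G]
    · simp only [G, Finsupp.add_apply, Finsupp.smul_apply, Finsupp.finsetSum_apply, smul_eq_mul]
      cases v with
      | a => simp [← Finset.sum_mul]; omega
      | b => simp [← Finset.sum_mul]; omega
      | c => simpa using h4
      | d => simpa using h5
      | x i => have : α i + 2 * β i ≤ e (.x i) := h6 i; simp [single_apply]; omega
      | y i => have : 2 * α i + β i ≤ e (.y i) := h7 i; simp [single_apply]; omega

end Strange

/-! ### Depth of the powers -/

section StrangeDepth

open Finsupp Pointwise RingTheory.Sequence

theorem depthFunction_strangeIdeal (K : Type*) [Field K] (n k : ℕ) :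
    depthFunction (strangeIdeal K n) k = idealDepth (gradedMaximalIdeal K (Vars n))
      (MvPolynomial (Vars n) K ⧸
        Ideal.span ((fun e => monomial e (1 : K)) '' (k • strangeExponents n))) := by
  rw [depthFunction, strangeIdeal_eq_span, span_monomial_image_pow]

variable {n k : ℕ}

theorem exists_le_add_single_a_iff {w : Vars n →₀ ℕ} :
    (∃ g ∈ k • strangeExponents n, g ≤ w + single .a 1) ↔ DivisibleByPow k (w .a + 1) (w .b)
      (w .c) (w .d) (fun i => w (.x i)) (fun i => w (.y i)) := by
  rw [exists_nsmul_strangeExponents_le_iff]; simp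

theorem exists_le_add_single_b_iff {w : Vars n →₀ ℕ} :
    (∃ g ∈ k • strangeExponents n, g ≤ w + single .b 1) ↔ DivisibleByPow k (w .a) (w .b + 1)
      (w .c) (w .d) (fun i => w (.x i)) (fun i => w (.y i)) := by
  rw [exists_nsmul_strangeExponents_le_iff]; simp

theorem exists_le_add_single_c_iff {w : Vars n →₀ ℕ} :
    (∃ g ∈ k • strangeExponents n, g ≤ w + single .c 1) ↔ DivisibleByPow k (w .a) (w .b)
      (w .c + 1) (w .d) (fun i => w (.x i)) (fun i => w (.y i)) := by
  rw [exists_nsmul_strangeExponents_le_iff]; simp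

theorem exists_le_add_single_d_iff {w : Vars n →₀ ℕ} :
    (∃ g ∈ k • strangeExponents n, g ≤ w + single .d 1) ↔ DivisibleByPow k (w .a) (w .b)
      (w .c) (w .d + 1) (fun i => w (.x i)) (fun i => w (.y i)) := by
  rw [exists_nsmul_strangeExponents_le_iff]; simp

theorem exists_le_add_single_x_iff {w : Vars n →₀ ℕ} {j : Fin n} :
    (∃ g ∈ k • strangeExponents n, g ≤ w + single (.x j) 1) ↔ DivisibleByPow k (w .a) (w .b)
      (w .c) (w .d) (Function.update (fun i => w (.x i)) j (w (.x j) + 1))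
        (fun i => w (.y i)) := by
  classical
  rw [exists_nsmul_strangeExponents_le_iff]
  have : (fun i => (w + single (Vars.x j) 1 : Vars n →₀ ℕ) (Vars.x i)) =
      Function.update (fun i => w (.x i)) j (w (.x j) + 1) := by
    funext i
    by_cases h : i = j
    · subst h; simp
    · simp [h]
  rw [this]; simp

theorem exists_le_add_single_y_iff {w : Vars n →₀ ℕ} {j : Fin n} :
    (∃ g ∈ k • strangeExponents n, g ≤ w + single (.y j) 1) ↔ DivisibleByPow k (w .a) (w .b)
      (w .c) (w .d) (fun i => w (.x i))
        (Function.update (fun i => w (.y i)) j (w (.y j) + 1)) := by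
  classical
  rw [exists_nsmul_strangeExponents_le_iff]
  have : (fun i => (w + single (Vars.y j) 1 : Vars n →₀ ℕ) (Vars.y i)) =
      Function.update (fun i => w (.y i)) j (w (.y j) + 1) := by
    funext i
    by_cases h : i = j
    · subst h; simp
    · simp [h]
  rw [this]; simp

/-- The exceptional set `Z` is only ever needed among `c`, `d` and the `yᵢ`, so the conditions for
the other variables are imposed outright. -/
theorem depthFunction_strangeIdeal_le (K : Type*) [Field K] {ea eb ec ed : ℕ} {ex ey : Fin n → ℕ}
    (hn : ¬ DivisibleByPow k ea eb ec ed ex ey) (Z : Finset (Vars n))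
    (ha : DivisibleByPow k (ea + 1) eb ec ed ex ey)
    (hb : DivisibleByPow k ea (eb + 1) ec ed ex ey)
    (hc : .c ∉ Z → DivisibleByPow k ea eb (ec + 1) ed ex ey)
    (hd : .d ∉ Z → DivisibleByPow k ea eb ec (ed + 1) ex ey)
    (hx : ∀ i, DivisibleByPow k ea eb ec ed (Function.update ex i (ex i + 1)) ey)
    (hy : ∀ i, .y i ∉ Z → DivisibleByPow k ea eb ec ed ex (Function.update ey i (ey i + 1))) :
    depthFunction (strangeIdeal K n) k ≤ Z.card := by
  rw [depthFunction_strangeIdeal]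
  let w : Vars n →₀ ℕ := Finsupp.equivFunOnFinite.symm fun v => match v with
    | .a => ea
    | .b => eb
    | .c => ec
    | .d => ed
    | .x i => ex i
    | .y i => ey i
  refine idealDepth_le_of_monomial (w := w)
    (fun h => hn (exists_nsmul_strangeExponents_le_iff.mp h)) fun v hv => ?_
  cases v with
  | a => exact exists_le_add_single_a_iff.mpr ha
  | b => exact exists_le_add_single_b_iff.mpr hb
  | c => exact exists_le_add_single_c_iff.mpr (hc hv)
  | d => exact exists_le_add_single_d_iff.mpr (hd hv)
  | x i => exact exists_le_add_single_x_iff.mpr (hx i)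
  | y i => exact exists_le_add_single_y_iff.mpr (hy i hv)

theorem span_nsmul_strangeExponents_le (K : Type*) [Field K] (hk : 1 ≤ k) :
    Ideal.span ((fun e => monomial e (1 : K)) '' (k • strangeExponents n)) ≤
      gradedMaximalIdeal K (Vars n) := by
  intro f hf
  rw [mem_gradedMaximalIdeal_iff]
  by_contra h
  obtain ⟨r₁, r₂, r₃, r₄, p, q, α, β, h1, h2, h3, h4, h5, -, -⟩ :=
    exists_nsmul_strangeExponents_le_iff.mp
      (mem_ideal_span_monomial_image.mp hf 0 (MvPolynomial.mem_support_iff.mpr h))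
  simp only [Finsupp.coe_zero, Pi.zero_apply] at h2 h3 h4 h5
  omega

theorem one_le_depthFunction_strangeIdeal (K : Type*) [Field K] (hk : 1 ≤ k) (he : Even k) :
    1 ≤ depthFunction (strangeIdeal K n) k := by
  obtain ⟨r, hr, hreg⟩ := exists_isSMulRegular_of_no_socle (K := K)
    (E := k • strangeExponents n) fun w hw => exists_nsmul_strangeExponents_le_iff.mpr
      (divisibleByPow_of_even he (exists_le_add_single_c_iff.mp (hw .c))
        (fun i => exists_le_add_single_x_iff.mp (hw (.x i)))
        fun i => exists_le_add_single_y_iff.mp (hw (.y i)))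
  rw [depthFunction_strangeIdeal]
  have hmem : ∀ s ∈ [r], s ∈ gradedMaximalIdeal K (Vars n) := by simpa using hr
  exact length_le_idealDepth hmem (isRegular_of_isWeaklyRegular_quotient
    isMaximal_gradedMaximalIdeal.ne_top (span_nsmul_strangeExponents_le K hk) hmem
    ((isWeaklyRegular_singleton_iff _ _).mpr hreg))

theorem two_le_depthFunction_strangeIdeal (K : Type*) [Field K] (hk : 2 * n + 1 < k) :
    2 ≤ depthFunction (strangeIdeal K n) k := by
  rw [depthFunction_strangeIdeal]
  have hmem : ∀ s ∈ ([X .c, X .d] : List (MvPolynomial (Vars n) K)),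
      s ∈ gradedMaximalIdeal K (Vars n) := by
    intro s hs
    simp only [List.mem_cons, List.not_mem_nil, or_false] at hs
    rcases hs with rfl | rfl <;> exact X_mem_gradedMaximalIdeal _
  refine length_le_idealDepth hmem (isRegular_of_isWeaklyRegular_quotient
    isMaximal_gradedMaximalIdeal.ne_top (span_nsmul_strangeExponents_le K (by omega)) hmem
    (isWeaklyRegular_X_X (by simp) (fun w hw => ?_) fun w hw => ?_))
  · exact exists_nsmul_strangeExponents_le_iff.mpr
      (divisibleByPow_of_two_mul_add_one_lt hk (exists_le_add_single_c_iff.mp hw))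
  · exact exists_nsmul_strangeExponents_le_iff.mpr
      (divisibleByPow_of_two_mul_add_one_lt hk (exists_le_add_single_d_iff.mp hw).swap_cd).swap_cd

theorem depthFunction_strangeIdeal_le_two (K : Type*) [Field K] (hk : 2 ≤ k) :
    depthFunction (strangeIdeal K n) k ≤ 2 := by
  classical
  have hsingle : ∀ i : Fin n, ∑ j, Pi.single (M := fun _ => ℕ) i 1 j = 1 := fun i => by simp
  have hle : ∀ i j : Fin n, Pi.single (M := fun _ => ℕ) i 1 j ≤ 1 := fun i j => by
    by_cases h : j = i
    · subst h; simp
    · simp [h]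
  have hupd : ∀ i j : Fin n,
      2 * Pi.single (M := fun _ => ℕ) i 1 j ≤ Function.update (fun _ => 1) i (1 + 1) j :=
    fun i j => by
      by_cases h : j = i
      · subst h; simp
      · simp [h]
  -- With `b`-exponent 4 and no `c, d`, only `a⁶` and at most `min k 4` factors `a⁵b` are usable,
  -- requiring `a`-degree at least `6k - min k 4`. The witness lies one below this, and every
  -- variable except `c, d` multiplies it into the power.
  refine (depthFunction_strangeIdeal_le K (k := k) (ea := 6 * k - 1 - min k 4) (eb := 4) (ec := 0)
    (ed := 0) (ex := fun _ => 1) (ey := fun _ => 1) ?_ {Vars.c, Vars.d} ?_ ?_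
    (fun h => absurd (by simp) h) (fun h => absurd (by simp) h) ?_ ?_).trans
    (Nat.cast_le.mpr Finset.card_le_two)
  · rintro ⟨r₁, r₂, r₃, r₄, p, q, α, β, h1, h2, h3, h4, h5, h6, h7⟩
    have hα : ∑ i, α i = 0 := Finset.sum_eq_zero fun i _ => by
      have : 2 * α i + β i ≤ 1 := h7 i
      omega
    have hβ : ∑ i, β i = 0 := Finset.sum_eq_zero fun i _ => by
      have : α i + 2 * β i ≤ 1 := h6 i
      omega
    have hr₃ : r₃ = 0 := by omega
    have hr₄ : r₄ = 0 := by omega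
    omega
  · exact ⟨k - min k 4, min k 4, 0, 0, 0, 0, 0, 0, by simp, by simp; omega, by simp, by simp,
      by simp, by simp, by simp⟩
  · exact ⟨k - 1, 0, 1, 0, 0, 0, 0, 0, by simp; omega, by simp; omega, by simp, by simp,
      by simp, by simp, by simp⟩
  · intro i
    refine ⟨k - 1, 0, 0, 0, 0, 0, 0, Pi.single i 1, by rw [hsingle]; simp; omega,
      by simp; omega, by rw [hsingle], by simp, by simp, fun j => ?_, fun j => ?_⟩
    · simpa using hupd i j
    · simpa using hle i j
  · intro i _
    refine ⟨k - 1 - min (k - 1) 4, min (k - 1) 4, 0, 0, 0, 0, Pi.single i 1, 0,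
      by rw [hsingle]; simp; omega, by rw [hsingle]; omega, by simp, by simp, by simp,
      fun j => ?_, fun j => ?_⟩
    · simpa using hle i j
    · simpa using hupd i j

theorem sum_ite_val_lt {m : ℕ} (h : m ≤ n) :
    ∑ i : Fin n, (if (i : ℕ) < m then 1 else 0) = m := by
  rw [Fin.sum_univ_eq_sum_range (fun i => if i < m then 1 else 0), Finset.sum_boole]
  simp only [Nat.cast_id]
  rw [show Finset.filter (· < m) (Finset.range n) = Finset.range m by ext; simp; omega,
    Finset.card_range]

/-- The witness is a tight monomial with both factors at indices below `t`, only `xᵢyᵢ²` for `t ≤ i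
< s`, and neither from `s` on. Only the `yᵢ` of the middle range can fail to multiply it into the
power. -/
theorem depthFunction_strangeIdeal_le_card (K : Type*) [Field K] {s t : ℕ} (hts : t ≤ s)
    (hs : s ≤ n) (Z : Finset (Vars n)) (hZ : ∀ i : Fin n, t ≤ i → (i : ℕ) < s → .y i ∈ Z) :
    depthFunction (strangeIdeal K n) (s + t + 1) ≤ Z.card := by
  let α : Fin n → ℕ := fun i => if (i : ℕ) < s then 1 else 0
  let β : Fin n → ℕ := fun i => if (i : ℕ) < t then 1 else 0
  let ex : Fin n → ℕ := fun i => if (i : ℕ) < t then 3 else 1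
  let ey : Fin n → ℕ := fun i => if (i : ℕ) < t then 3 else if (i : ℕ) < s then 2 else 1
  have hcase : ∀ i, (α i = 1 ∧ β i = 1 ∧ ex i = 3 ∧ ey i = 3) ∨
      (α i = 1 ∧ β i = 0 ∧ ex i = 1 ∧ ey i = 2 ∧ .y i ∈ Z) ∨
      (α i = 0 ∧ β i = 0 ∧ ex i = 1 ∧ ey i = 1) := by
    intro i
    by_cases h1 : (i : ℕ) < t
    · left; simp [α, β, ex, ey, h1, h1.trans_le hts]
    · by_cases h2 : (i : ℕ) < s
      · right; left; simp [α, β, ex, ey, h1, h2, hZ i (by omega) h2]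
      · right; right; simp [α, β, ex, ey, h1, h2]
  have htight : IsTight α β ex ey := fun i => by have := hcase i; omega
  have hα : ∑ i, α i = s := sum_ite_val_lt hs
  have hβ : ∑ i, β i = t := sum_ite_val_lt (hts.trans hs)
  have h6 : ∀ i, α i + 2 * β i ≤ ex i := fun i => by have := hcase i; omega
  have h7 : ∀ i, 2 * α i + β i ≤ ey i := fun i => by have := hcase i; omega
  have hn := htight.not_divisibleByPow
  clear_value α β ex ey
  have hk : s + t + 1 = ∑ i, α i + ∑ i, β i + 1 := by omega
  rw [← hk] at hn
  refine depthFunction_strangeIdeal_le K hn Z ?_ ?_ (fun _ => ?_) (fun _ => ?_) (fun i => ?_)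
    (fun i hi => ?_)
  · exact ⟨0, 1, 0, 0, 0, 0, α, β, by omega, by omega, by omega, by omega, by omega, h6, h7⟩
  · exact ⟨0, 0, 1, 0, 0, 0, α, β, by omega, by omega, by omega, by omega, by omega, h6, h7⟩
  · exact ⟨0, 0, 0, 0, 1, 0, α, β, by omega, by omega, by omega, by omega, by omega, h6, h7⟩
  · exact ⟨0, 0, 0, 0, 0, 1, α, β, by omega, by omega, by omega, by omega, by omega, h6, h7⟩
  · have hex : ∀ j, ex j ≤ Function.update ex i (ex i + 1) j := fun j => by
      by_cases h : j = i
      · subst h; simp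
      · simp [h]
    have := divisibleByPow_of_exchange hk h6 h7 i
    -- The extra `xᵢ` lets `a⁴b⁴` and the factors at `i` be replaced by `a⁶(b⁴xᵢ²yᵢ)²`, `a⁶ ·
    -- b⁴xᵢ²yᵢ` or `b⁴xᵢ²yᵢ` respectively.
    rcases hcase i with h | h | h
    · exact this 0 2 1 0 (by omega) (by omega) (by omega) hex (fun _ => le_rfl)
        (by rw [Function.update_self]; omega) (by omega)
    · exact this 0 1 1 0 (by omega) (by omega) (by omega) hex (fun _ => le_rfl)
        (by rw [Function.update_self]; omega) (by omega)
    · exact this 0 1 0 0 (by omega) (by omega) (by omega) hex (fun _ => le_rfl)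
        (by rw [Function.update_self]; omega) (by omega)
  · have hey : ∀ j, ey j ≤ Function.update ey i (ey i + 1) j := fun j => by
      by_cases h : j = i
      · subst h; simp
      · simp [h]
    have := divisibleByPow_of_exchange hk h6 h7 i
    rcases hcase i with h | h | h
    · exact this 2 0 0 1 (by omega) (by omega) (by omega) (fun _ => le_rfl) hey
        (by omega) (by rw [Function.update_self]; omega)
    · exact absurd h.2.2.2.2 hi
    · exact this 1 0 0 0 (by omega) (by omega) (by omega) (fun _ => le_rfl) hey
        (by omega) (by rw [Function.update_self]; omega)

end StrangeDepth

theorem theorem1 (K : Type*) [Field K] (n : ℕ) :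
    (∀ k : ℕ, Odd k → k ≤ 2 * n + 1 → depthFunction (strangeIdeal K n) k = 0) ∧
    (∀ k : ℕ, 1 ≤ k → Even k → k ≤ 2 * n → depthFunction (strangeIdeal K n) k = 1) ∧
    (∀ k : ℕ, 2 * n + 1 < k → depthFunction (strangeIdeal K n) k = 2) ∧
    {k : ℕ | IsStrictLocalMaxAt (depthFunction (strangeIdeal K n)) k}.encard = n := by
  have hodd : ∀ k : ℕ, Odd k → k ≤ 2 * n + 1 → depthFunction (strangeIdeal K n) k = 0 := by
    rintro k ⟨m, rfl⟩ hk
    have := depthFunction_strangeIdeal_le_card K (le_refl m) (by omega : m ≤ n) ∅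
      fun i h1 h2 => by omega
    rw [← two_mul] at this
    simpa using this
  have heven : ∀ k : ℕ, 1 ≤ k → Even k → k ≤ 2 * n →
      depthFunction (strangeIdeal K n) k = 1 := by
    rintro k h1 he hk
    refine le_antisymm ?_ (one_le_depthFunction_strangeIdeal K h1 he)
    obtain ⟨m, rfl⟩ := he
    obtain ⟨m, rfl⟩ := Nat.exists_eq_succ_of_ne_zero (n := m) (by omega)
    -- Taking `s = m + 1`, `t = m` leaves a single index, hence a single `yᵢ`, in `Z`.
    have := depthFunction_strangeIdeal_le_card K (Nat.le_succ m) (by omega : m + 1 ≤ n)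
      {.y ⟨m, by omega⟩} fun i h1 h2 => by
        simp only [Finset.mem_singleton, Vars.y.injEq, Fin.ext_iff]; omega
    rw [Finset.card_singleton, Nat.cast_one] at this
    rwa [show m.succ + m.succ = m.succ + m + 1 by omega]
  have hlarge : ∀ k : ℕ, 2 * n + 1 < k → depthFunction (strangeIdeal K n) k = 2 := fun k hk =>
    le_antisymm (depthFunction_strangeIdeal_le_two K (by omega))
      (two_le_depthFunction_strangeIdeal K hk)
  refine ⟨hodd, heven, hlarge, ?_⟩
  -- The maxima are the even `k` from `2` to `2n`: beyond `2n + 1` the function is constant, so `2n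
  -- + 2` is not strict.
  have hset : {k : ℕ | IsStrictLocalMaxAt (depthFunction (strangeIdeal K n)) k} =
      ((Finset.range n).image fun m => 2 * m + 2 : Finset ℕ) := by
    ext k
    simp only [Set.mem_ofPred_eq, Finset.coe_image, Finset.coe_range, Set.mem_image, Set.mem_Iio]
    constructor
    · rintro ⟨h1, hmax⟩
      have hlt := hmax (k + 1) (by omega) (Or.inr rfl)
      rcases lt_or_ge (2 * n + 1) k with hk | hk
      · rw [hlarge k hk, hlarge (k + 1) (by omega)] at hlt
        exact absurd hlt (lt_irrefl _)
      · rcases Nat.even_or_odd k with he | ho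
        · obtain ⟨m, rfl⟩ := he
          exact ⟨m - 1, by omega, by omega⟩
        · rw [hodd k ho hk] at hlt
          exact absurd hlt not_lt_zero
    · rintro ⟨m, hm, rfl⟩
      refine ⟨by omega, fun j hj hjk => ?_⟩
      rw [heven (2 * m + 2) (by omega) ⟨m + 1, by omega⟩ (by omega),
        hodd j (by rcases hjk with h | h; exacts [⟨m, by omega⟩, ⟨m + 1, by omega⟩]) (by omega)]
      exact zero_lt_one
  rw [hset, Set.encard_coe_eq_coe_finsetCard,
    Finset.card_image_of_injective _ fun a b h => by simpa using h, Finset.card_range]
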